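/- Let $p_0,p_1$ be probability densities on a finite set $\mathcal X$, identified with the diagonal matrices $\sum_{x}p_\theta(x)|e_x\rangle\langle e_x|$, and let $\sigma_0,\sigma_1$ be density operators on a finite dimensional complex Hilbert space $\mathcal H$. For a convex function $f:[0,\infty)\to(-\infty,\infty]$ that is finite on $(0,\infty)$ put $$D_f(p_0\|p_1):=\sum_{x:\,p_1(x)\neq 0}p_1(x)\,f\!\left(\frac{p_0(x)}{p_1(x)}\right)+\Big(\sum_{x:\,p_1(x)=0}p_0(x)\Big)\lim_{\lambda\to\infty}\frac{f(\lambda)}{\lambda}\in(-\infty,\infty]$$ (with $0\cdot\infty=0$), and let $D_f^{\max}(\sigma_0\|\sigma_1)$ be the infimum of $D_f(q_0\|q_1)$ over all pairs of probability densities $q_0,q_1$ on finite sets for which there is a completely positive trace preserving (CPTP) map $\Gamma$ with $\Gamma(q_\theta)=\sigma_\theta$, $\theta=0,1$. (a) If $D_f(p_0\|p_1)=D_f^{\max}(\sigma_0\|\sigma_1)$ for every continuous operator convex function $f:[0,\infty)\to\mathbb R$, then there is a CPTP map $\Gamma$ with $\Gamma(p_\theta)=\sigma_\theta$ for $\theta=0,1$.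 (b) In fact, let $s_0\in(0,1)$ be arbitrary. If the identity $D_f(p_0\|p_1)=D_f^{\max}(\sigma_0\|\sigma_1)$ holds for $f(\lambda)=(t+\lambda)^{-1}$ for all $t\ge 0$ (where for $t=0$ the value at $\lambda=0$ is $+\infty$), and for $f(\lambda)=-\lambda^s$ for all $s\in(s_0,1)$, then there is a CPTP map $\Gamma$ with $\Gamma(p_\theta)=\sigma_\theta$ for $\theta=0,1$. -/

import Mathlib

open scoped ComplexOrder MatrixOrder Matrix.Norms.L2Operator

noncomputable section

/-- The slope at infinity `lim_{x → ∞} f x / x`. For a convex `f` the limit exists in the extended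
reals, and the limit superior is then this limit. -/
def slopeAtTop (f : ℝ → EReal) : EReal :=
  Filter.limsup (fun x : ℝ => f x / (x : EReal)) Filter.atTop

/-- The classical `f`-divergence `D_f(p₀ ‖ p₁)` of two probability densities on a finite set, for an
extended real valued `f` on `[0, ∞)`, with the convention `0 · (±∞) = 0`. -/
def fDivergence {X : Type*} [Fintype X] (f : ℝ → EReal) (p₀ p₁ : X → ℝ) : EReal :=
  (∑ x with p₁ x ≠ 0, (p₁ x : EReal) * f (p₀ x / p₁ x)) +
    ((∑ x with p₁ x = 0, p₀ x : ℝ) : EReal) * slopeAtTop f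

/-- Density operators (quantum states). -/
def IsDensityMatrix {n : Type*} [Fintype n] (σ : Matrix n n ℂ) : Prop :=
  σ.PosSemidef ∧ σ.trace = 1

/-- A density `p` on `X`, regarded as the diagonal matrix `∑ x, p x |e_x⟩⟨e_x|`. -/
def densityToMatrix {X : Type*} [DecidableEq X] (p : X → ℝ) : Matrix X X ℂ :=
  Matrix.diagonal fun x => (p x : ℂ)

/-- There is a completely positive trace preserving map `Γ` with `Γ p₀ = σ₀` and `Γ p₁ = σ₁`. -/
def ExistsCPTP {X n : Type*} [Fintype X] [DecidableEq X] [Fintype n] [DecidableEq n]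
    (p₀ p₁ : X → ℝ) (σ₀ σ₁ : Matrix n n ℂ) : Prop :=
  ∃ Γ : CompletelyPositiveMap (Matrix X X ℂ) (Matrix n n ℂ),
    (∀ A : Matrix X X ℂ, (Γ A).trace = A.trace) ∧
      Γ (densityToMatrix p₀) = σ₀ ∧ Γ (densityToMatrix p₁) = σ₁

/-- The maximal quantum `f`-divergence: the infimum of the classical `f`-divergences of all pairs of
probability densities on finite sets that some CPTP map sends to `(σ₀, σ₁)`. -/
def maxFDivergence {n : Type*} [Fintype n] [DecidableEq n]
    (f : ℝ → EReal) (σ₀ σ₁ : Matrix n n ℂ) : EReal :=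
  sInf {d | ∃ (k : ℕ) (q₀ q₁ : Fin k → ℝ), q₀ ∈ stdSimplex ℝ (Fin k) ∧ q₁ ∈ stdSimplex ℝ (Fin k) ∧
    ExistsCPTP q₀ q₁ σ₀ σ₁ ∧ d = fDivergence f q₀ q₁}

/-- `f` is operator convex on `[0, ∞)`: for every size `m`, the map `A ↦ f(A)` given by the
functional calculus is convex, in the Loewner order, on the positive semidefinite matrices. -/
def OperatorConvex (f : ℝ → ℝ) : Prop :=
  ∀ m : ℕ, ConvexOn ℝ {A : Matrix (Fin m) (Fin m) ℂ | 0 ≤ A} (fun A => cfc f A)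

/-- The function `x ↦ (t + x)⁻¹` on `[0, ∞)`, for `t ≥ 0`, with the value `+∞` where `t + x = 0`
(that is, at `x = 0` if `t = 0`). -/
def invShift (t x : ℝ) : EReal :=
  if t + x = 0 then ⊤ else (((t + x)⁻¹ : ℝ) : EReal)

/-- The function `x ↦ -x ^ s` on `[0, ∞)`. -/
def negPow (s x : ℝ) : EReal := ((-(x ^ s) : ℝ) : EReal)

end

/-! Both parts reduce to the functions `f λ = (t + λ)⁻¹` with `t > 0`, for which the classical
divergence is `∑ p₁² / (p₀ + t p₁)` (`invDivergence`). By `existsCPTP_iff`, a CPTP map from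
densities to states amounts to writing `σ₀`, `σ₁` as mixtures, with weights `p₀`, `p₁`, of one
common family of states. One such reverse test `(q₀, q₁)` is optimal for every `t` simultaneously
(`exists_minimal_reverseTest`). It comes from a joint congruence `σ₀ = V (1 - C) Vᴴ`, `σ₁ = V C Vᴴ`
with `C` diagonal: the columns of `V` supply the states. Optimality follows by completing a square,
which bounds every reverse test below by a functional linear in `(σ₀, σ₁)`; `(q₀, q₁)` attains the
bound. The hypothesis therefore says that `(p₀, p₁)` and `(q₀, q₁)` have equal `invDivergence` for
all `t > 0`. A partial fraction argument recovers from these values the law of the likelihood ratio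
`p₁ / (p₀ + p₁)` under `p₀ + p₁` (`levelMass_eq_of_invDivergence_eq`). The likelihood ratio is a
sufficient statistic, so averaging the states of `q` over its level sets gives a preparation from
`p` (`ExistsCPTP.of_levelMass_eq`). -/

/-! ### Joint diagonalization of two positive matrices by congruence -/

section SimultaneousDiagonalization

open Matrix

variable {n : Type*} [Fintype n] [DecidableEq n]

/-- Unitary diagonalization of a Hermitian matrix, with the unitary given as a matrix. -/
lemma Matrix.IsHermitian.exists_unitary_diagonal {A : Matrix n n ℂ} (hA : A.IsHermitian) :
    ∃ (U : Matrix n n ℂ) (d : n → ℝ), U * Uᴴ = 1 ∧ Uᴴ * U = 1 ∧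
      A = U * diagonal (fun i => (d i : ℂ)) * Uᴴ := by
  refine ⟨hA.eigenvectorUnitary, hA.eigenvalues, ?_, ?_, ?_⟩
  · exact Unitary.coe_mul_star_self _
  · exact Unitary.coe_star_mul_self _
  · conv_lhs => rw [hA.spectral_theorem, Unitary.conjStarAlgAut_apply]
    rfl

/-- A positive semidefinite matrix that vanishes as a quadratic form on the range of `B` annihilates
that range. -/
lemma Matrix.PosSemidef.mul_eq_zero_of_conj_eq_zero {A B : Matrix n n ℂ} (hA : A.PosSemidef)
    (h : Bᴴ * A * B = 0) : A * B = 0 := by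
  obtain ⟨C, rfl⟩ := CStarAlgebra.nonneg_iff_eq_star_mul_self.mp (nonneg_iff_posSemidef.mpr hA)
  rw [star_eq_conjTranspose] at h ⊢
  have h' : (C * B)ᴴ * (C * B) = 0 := by
    rw [conjTranspose_mul, ← h]; simp only [Matrix.mul_assoc]
  rw [Matrix.mul_assoc, conjTranspose_mul_self_eq_zero.mp h', Matrix.mul_zero]

/-- A factorization `A = R * Rᴴ` of a positive semidefinite matrix together with a generalized
inverse `Q` of `R`. -/
lemma Matrix.PosSemidef.exists_factor_pseudoinverse {A : Matrix n n ℂ} (hA : A.PosSemidef) :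
    ∃ R Q : Matrix n n ℂ, A = R * Rᴴ ∧ R * Q * R = R ∧ Q * R * Q = Q ∧
      (R * Q)ᴴ = R * Q ∧ (Q * R)ᴴ = Q * R ∧ (1 - Q * R).PosSemidef := by
  obtain ⟨U, d, hU, hU', hd⟩ := hA.1.exists_unitary_diagonal
  have hd0 : ∀ i, 0 ≤ d i := by
    have h := hA.conjTranspose_mul_mul_same U
    have : Uᴴ * A * U = diagonal (fun i => (d i : ℂ)) := by
      rw [hd]
      calc Uᴴ * (U * diagonal (fun i => (d i : ℂ)) * Uᴴ) * U
          = (Uᴴ * U) * diagonal (fun i => (d i : ℂ)) * (Uᴴ * U) := by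
            simp only [Matrix.mul_assoc]
        _ = _ := by rw [hU', Matrix.one_mul, Matrix.mul_one]
    rw [this, posSemidef_diagonal_iff] at h
    exact fun i => by exact_mod_cast h i
  set s : Matrix n n ℂ := diagonal fun i => ((√(d i) : ℝ) : ℂ) with hs
  -- Since `0⁻¹ = 0`, `r` is the Moore–Penrose inverse of `s`, and `r * s` is the projection onto
  -- the nonzero eigenvalues.
  set r : Matrix n n ℂ := diagonal fun i => (((√(d i))⁻¹ : ℝ) : ℂ) with hr
  have hsr : r * s = diagonal fun i => if d i = 0 then (0 : ℂ) else 1 := by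
    rw [hs, hr, diagonal_mul_diagonal]
    congr 1; ext i
    split_ifs with h
    · simp [h]
    · have : √(d i) ≠ 0 := by rwa [Ne, Real.sqrt_eq_zero (hd0 i)]
      rw [← Complex.ofReal_mul, inv_mul_cancel₀ this, Complex.ofReal_one]
  have hcomm : s * r = r * s := by
    rw [hs, hr, diagonal_mul_diagonal, diagonal_mul_diagonal]
    congr 1; ext i; ring
  have hQR : r * Uᴴ * (U * s) = r * s := by
    rw [Matrix.mul_assoc, ← Matrix.mul_assoc Uᴴ, hU', Matrix.one_mul]
  have hherm : (r * s)ᴴ = r * s := by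
    rw [hsr, diagonal_conjTranspose]
    congr 1; ext i; simp only [Pi.star_apply]; split_ifs <;> simp
  have hsrs : s * (r * s) = s := by
    rw [hs, hr, diagonal_mul_diagonal, diagonal_mul_diagonal]
    congr 1; ext i
    rw [← Complex.ofReal_mul, ← Complex.ofReal_mul]
    congr 1
    by_cases h : √(d i) = 0
    · simp [h]
    · field_simp
  have hrsr : r * s * r = r := by
    rw [hs, hr, diagonal_mul_diagonal, diagonal_mul_diagonal]
    congr 1; ext i
    rw [← Complex.ofReal_mul, ← Complex.ofReal_mul]
    congr 1
    by_cases h : √(d i) = 0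
    · simp [h]
    · field_simp
  refine ⟨U * s, r * Uᴴ, ?_, ?_, ?_, ?_, ?_, ?_⟩
  · rw [hd, conjTranspose_mul, hs, diagonal_conjTranspose]
    have : diagonal (fun i => (d i : ℂ)) = (diagonal fun i => ((√(d i) : ℝ) : ℂ)) *
        diagonal (star fun i => ((√(d i) : ℝ) : ℂ)) := by
      rw [diagonal_mul_diagonal]
      congr 1; ext i
      rw [Pi.star_apply, Complex.star_def, Complex.conj_ofReal, ← Complex.ofReal_mul,
        Real.mul_self_sqrt (hd0 i)]
    rw [this]; simp only [Matrix.mul_assoc]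
  · rw [Matrix.mul_assoc, hQR, Matrix.mul_assoc, hsrs]
  · rw [hQR, ← Matrix.mul_assoc, hrsr]
  · have : U * s * (r * Uᴴ) = U * (r * s) * Uᴴ := by
      rw [← hcomm]; simp only [Matrix.mul_assoc]
    rw [this, conjTranspose_mul, conjTranspose_mul, hherm, conjTranspose_conjTranspose]
    simp only [Matrix.mul_assoc]
  · rw [hQR, hherm]
  · rw [hQR, hsr, ← diagonal_one, diagonal_sub, posSemidef_diagonal_iff]
    intro i
    by_cases h : d i = 0 <;> simp [h]

/-- Simultaneous diagonalization of two positive semidefinite matrices by congruence. The matrix `W`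
plays the role of an inverse of `V`, up to the joint kernel. -/
lemma exists_simultaneous_diagonalization {σ₀ σ₁ : Matrix n n ℂ} (h₀ : σ₀.PosSemidef)
    (h₁ : σ₁.PosSemidef) :
    ∃ (V W : Matrix n n ℂ) (c : n → ℝ), (∀ i, 0 ≤ c i) ∧ (∀ i, c i ≤ 1) ∧
      σ₀ = V * diagonal (fun i => ((1 - c i : ℝ) : ℂ)) * Vᴴ ∧
      σ₁ = V * diagonal (fun i => (c i : ℂ)) * Vᴴ ∧
      (W * V)ᴴ = W * V ∧
      W * V * diagonal (fun i => (c i : ℂ)) = diagonal (fun i => (c i : ℂ)) := by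
  obtain ⟨R, Q, hR, hRQR, hQRQ, hRQ, hQR, hpos⟩ := (h₀.add h₁).exists_factor_pseudoinverse
  -- `1 - R * Q` projects onto the kernel of `σ₀ + σ₁`; there the two nonnegative forms sum to zero,
  -- so each vanishes.
  have hker : σ₁ * (1 - R * Q) = 0 := by
    have hsum : (1 - R * Q)ᴴ * (σ₀ + σ₁) * (1 - R * Q) = 0 := by
      have : (1 - R * Q) * R = 0 := by rw [Matrix.sub_mul, hRQR, Matrix.one_mul, sub_self]
      rw [conjTranspose_sub, hRQ, conjTranspose_one, hR, ← Matrix.mul_assoc, this]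
      simp
    apply h₁.mul_eq_zero_of_conj_eq_zero
    have e₀ := h₀.conjTranspose_mul_mul_same (1 - R * Q)
    have e₁ := h₁.conjTranspose_mul_mul_same (1 - R * Q)
    rw [Matrix.mul_add, Matrix.add_mul] at hsum
    rw [← nonneg_iff_posSemidef] at e₀ e₁
    exact ((add_eq_zero_iff_of_nonneg e₀ e₁).mp hsum).2
  have hσR : σ₁ * (R * Q) = σ₁ := by
    rw [Matrix.mul_sub, Matrix.mul_one, sub_eq_zero] at hker; exact hker.symm
  have hσL : R * Q * σ₁ = σ₁ := by
    have := congrArg conjTranspose hσR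
    rwa [conjTranspose_mul, hRQ, h₁.1.eq] at this
  -- `T` is a noncommutative Radon–Nikodym derivative of `σ₁` with respect to `σ₀ + σ₁`; the `c i`
  -- are its eigenvalues.
  set T := Q * σ₁ * Qᴴ with hT
  have hT₁ : R * T * Rᴴ = σ₁ := by
    calc R * T * Rᴴ = R * Q * σ₁ * (R * Q)ᴴ := by
          rw [hT, conjTranspose_mul]; simp only [Matrix.mul_assoc]
      _ = σ₁ := by rw [hσL, hRQ, hσR]
  have hTpos : T.PosSemidef := h₁.mul_mul_conjTranspose_same Q
  have hTle : (1 - T).PosSemidef := by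
    have h : 1 - T = (1 - Q * R) + Q * σ₀ * Qᴴ := by
      have : Q * (σ₀ + σ₁) * Qᴴ = Q * R := by
        calc Q * (σ₀ + σ₁) * Qᴴ = Q * R * (Q * R)ᴴ := by
              rw [hR, conjTranspose_mul]; simp only [Matrix.mul_assoc]
          _ = Q * R := by rw [hQR, ← Matrix.mul_assoc, hQRQ]
      rw [← this, Matrix.mul_add, Matrix.add_mul, hT]; abel
    rw [h]
    exact hpos.add (h₀.mul_mul_conjTranspose_same Q)
  have hQT : Q * R * T = T := by
    rw [hT, ← Matrix.mul_assoc, ← Matrix.mul_assoc, hQRQ]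
  obtain ⟨U, c, hU, hU', hc⟩ := hTpos.1.exists_unitary_diagonal
  have hc' : Uᴴ * T * U = diagonal (fun i => (c i : ℂ)) := by
    rw [hc]
    calc Uᴴ * (U * diagonal (fun i => (c i : ℂ)) * Uᴴ) * U
        = (Uᴴ * U) * diagonal (fun i => (c i : ℂ)) * (Uᴴ * U) := by simp only [Matrix.mul_assoc]
      _ = _ := by rw [hU', Matrix.one_mul, Matrix.mul_one]
  have hc1 : Uᴴ * (1 - T) * U = diagonal (fun i => ((1 - c i : ℝ) : ℂ)) := by
    rw [Matrix.mul_sub, Matrix.sub_mul, hc', Matrix.mul_one, hU', ← diagonal_one, diagonal_sub]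
    congr 1; ext i; simp
  have hUc1 : U * diagonal (fun i => ((1 - c i : ℝ) : ℂ)) * Uᴴ = 1 - T := by
    rw [← hc1]
    calc U * (Uᴴ * (1 - T) * U) * Uᴴ = (U * Uᴴ) * (1 - T) * (U * Uᴴ) := by
          simp only [Matrix.mul_assoc]
      _ = _ := by rw [hU, Matrix.one_mul, Matrix.mul_one]
  have hWV : Uᴴ * Q * (R * U) = Uᴴ * (Q * R) * U := by simp only [Matrix.mul_assoc]
  refine ⟨R * U, Uᴴ * Q, c, ?_, ?_, ?_, ?_, ?_, ?_⟩
  · have h := hTpos.conjTranspose_mul_mul_same U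
    rw [hc', posSemidef_diagonal_iff] at h
    exact fun i => by exact_mod_cast h i
  · have h := hTle.conjTranspose_mul_mul_same U
    rw [hc1, posSemidef_diagonal_iff] at h
    intro i
    have := h i
    rw [Complex.zero_le_real] at this
    linarith
  · calc σ₀ = R * Rᴴ - σ₁ := by rw [← hR]; abel
      _ = R * (1 - T) * Rᴴ := by
        rw [Matrix.mul_sub, Matrix.sub_mul, hT₁, Matrix.mul_one]
      _ = _ := by
        rw [← hUc1, conjTranspose_mul]; simp only [Matrix.mul_assoc]
  · calc σ₁ = R * T * Rᴴ := hT₁.symm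
      _ = _ := by rw [hc, conjTranspose_mul]; simp only [Matrix.mul_assoc]
  · rw [hWV, conjTranspose_mul, conjTranspose_mul, hQR, conjTranspose_conjTranspose]
    simp only [Matrix.mul_assoc]
  · calc Uᴴ * Q * (R * U) * diagonal (fun i => (c i : ℂ))
        = Uᴴ * (Q * R) * U * (Uᴴ * T * U) := by rw [hWV, hc']
      _ = Uᴴ * (Q * R) * (U * Uᴴ) * T * U := by simp only [Matrix.mul_assoc]
      _ = Uᴴ * (Q * R * T) * U := by rw [hU, Matrix.mul_one]; simp only [Matrix.mul_assoc]
      _ = _ := by rw [hQT, hc']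

end SimultaneousDiagonalization

/-! ### Preparation maps and mixtures of states -/

section ReverseTest

open Matrix

/-- Nonnegative elements of a C⋆-algebra are of the form `star b * b`. -/
lemma CStarAlgebra.exists_eq_star_mul_self_of_nonneg {A : Type*} [NonUnitalCStarAlgebra A]
    [PartialOrder A] [StarOrderedRing A] {a : A} (ha : 0 ≤ a) : ∃ b : A, a = star b * b :=
  CStarAlgebra.nonneg_iff_eq_star_mul_self.mp ha

variable {X Y n : Type*} [Fintype X] [DecidableEq X] [Fintype Y] [DecidableEq Y] [Fintype n]
  [DecidableEq n]

/-- The linear map `A ↦ ∑ x, A x x • τ x`. -/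
noncomputable def prepareLinearMap {X n : Type*} [Fintype X] (τ : X → Matrix n n ℂ) :
    Matrix X X ℂ →ₗ[ℂ] Matrix n n ℂ where
  toFun A := ∑ x, A x x • τ x
  map_add' A B := by simp [add_smul, Finset.sum_add_distrib]
  map_smul' r A := by simp [Finset.smul_sum, smul_smul]

lemma prepareLinearMap_apply {X n : Type*} [Fintype X] (τ : X → Matrix n n ℂ) (A : Matrix X X ℂ) :
    prepareLinearMap τ A = ∑ x, A x x • τ x := rfl

/-- This is complete positivity. With `M = star N * N` and `τ x = star (B x) * B x`, the image is
the sum over `x, y` of the squares of the matrices with entries `(N l j) y x • B x`. -/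
lemma prepareLinearMap_map_nonneg {τ : X → Matrix n n ℂ} (hτ : ∀ x, (τ x).PosSemidef) (k : ℕ)
    (M : CStarMatrix (Fin k) (Fin k) (Matrix X X ℂ)) (hM : 0 ≤ M) :
    0 ≤ M.map (prepareLinearMap τ) := by
  obtain ⟨N, rfl⟩ := CStarAlgebra.exists_eq_star_mul_self_of_nonneg hM
  choose B hB using fun x =>
    CStarAlgebra.nonneg_iff_eq_star_mul_self.mp (nonneg_iff_posSemidef.mpr (hτ x))
  let Q : X → X → CStarMatrix (Fin k) (Fin k) (Matrix n n ℂ) :=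
    fun x y => CStarMatrix.ofMatrix (Matrix.of fun l j => (N l j) y x • B x)
  have key : (star N * N).map (prepareLinearMap τ) = ∑ x, ∑ y, star (Q x y) * Q x y := by
    ext1 i j
    have happ : ∀ F : X → CStarMatrix (Fin k) (Fin k) (Matrix n n ℂ),
        (∑ x, F x) i j = ∑ x, F x i j := fun F => Matrix.sum_apply i j Finset.univ F
    rw [CStarMatrix.map_apply, prepareLinearMap_apply, happ]
    refine Finset.sum_congr rfl fun x _ => ?_
    rw [happ, CStarMatrix.mul_apply, Matrix.sum_apply, hB x, Finset.sum_smul]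
    simp_rw [CStarMatrix.mul_apply, CStarMatrix.star_apply]
    rw [Finset.sum_comm]
    refine Finset.sum_congr rfl fun l _ => ?_
    rw [Matrix.mul_apply, Finset.sum_smul]
    refine Finset.sum_congr rfl fun y _ => ?_
    change (star (N l i) x y * N l j y x) • (star (B x) * B x) =
      star (N l i y x • B x) * (N l j y x • B x)
    rw [star_smul, smul_mul_smul_comm]
    rfl
  rw [key]
  exact Finset.sum_nonneg fun x _ => Finset.sum_nonneg fun y _ => star_mul_self_nonneg _

/-- A pair of densities is mapped to a pair of matrices by a CPTP map iff the matrices are the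
mixtures of a common family of states. -/
lemma existsCPTP_iff {p₀ p₁ : X → ℝ} {σ₀ σ₁ : Matrix n n ℂ} :
    ExistsCPTP p₀ p₁ σ₀ σ₁ ↔ ∃ τ : X → Matrix n n ℂ, (∀ x, IsDensityMatrix (τ x)) ∧
      ∑ x, (p₀ x : ℂ) • τ x = σ₀ ∧ ∑ x, (p₁ x : ℂ) • τ x = σ₁ := by
  constructor
  · rintro ⟨Γ, htr, h₀, h₁⟩
    have hsum : ∀ p : X → ℝ,
        ∑ x, (p x : ℂ) • Γ (Matrix.single x x 1) = Γ (densityToMatrix p) := by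
      intro p
      have : densityToMatrix p = ∑ x, (p x : ℂ) • Matrix.single x x (1 : ℂ) := by
        rw [densityToMatrix, ← Matrix.sum_single_eq_diagonal]
        simp [Matrix.smul_single]
      rw [this, map_sum]
      simp_rw [map_smul]
    refine ⟨fun x => Γ (Matrix.single x x 1), fun x => ⟨?_, ?_⟩, ?_, ?_⟩
    · rw [← nonneg_iff_posSemidef]
      apply map_nonneg Γ
      rw [nonneg_iff_posSemidef, ← Matrix.diagonal_single, posSemidef_diagonal_iff]
      exact Pi.single_nonneg.mpr zero_le_one
    · rw [htr, Matrix.trace_single_eq_same]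
    · rw [hsum, h₀]
    · rw [hsum, h₁]
  · rintro ⟨τ, hτ, h₀, h₁⟩
    refine ⟨⟨prepareLinearMap τ, prepareLinearMap_map_nonneg fun x => (hτ x).1⟩, ?_, ?_, ?_⟩
    · intro A
      change (prepareLinearMap τ A).trace = _
      rw [prepareLinearMap_apply, Matrix.trace_sum]
      simp_rw [Matrix.trace_smul, (hτ _).2, smul_eq_mul, mul_one]
      rfl
    · change prepareLinearMap τ (densityToMatrix p₀) = _
      simp_rw [prepareLinearMap_apply, densityToMatrix, Matrix.diagonal_apply_eq, h₀]
    · change prepareLinearMap τ (densityToMatrix p₁) = _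
      simp_rw [prepareLinearMap_apply, densityToMatrix, Matrix.diagonal_apply_eq, h₁]

lemma ExistsCPTP.comp_equiv {p₀ p₁ : X → ℝ} {σ₀ σ₁ : Matrix n n ℂ} (h : ExistsCPTP p₀ p₁ σ₀ σ₁)
    (e : Y ≃ X) : ExistsCPTP (p₀ ∘ e) (p₁ ∘ e) σ₀ σ₁ := by
  obtain ⟨τ, hτ, h₀, h₁⟩ := existsCPTP_iff.mp h
  refine existsCPTP_iff.mpr ⟨τ ∘ e, fun y => hτ (e y), ?_, ?_⟩
  · rw [← h₀]; exact e.sum_comp fun x => (p₀ x : ℂ) • τ x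
  · rw [← h₁]; exact e.sum_comp fun x => (p₁ x : ℂ) • τ x

end ReverseTest

/-! ### The reverse test that is optimal for all `t` -/

section MinimalReverseTest

open Matrix

variable {X n : Type*} [Fintype X] [DecidableEq X] [Fintype n] [DecidableEq n]

/-- The classical `f`-divergence for `f x = (t + x)⁻¹`, written as a real number. -/
noncomputable def invDivergence {X : Type*} [Fintype X] (t : ℝ) (p₀ p₁ : X → ℝ) : ℝ :=
  ∑ x, p₁ x ^ 2 / (p₀ x + t * p₁ x)

/-- The single-state case of the variational bound for `invDivergence`. -/
lemma IsDensityMatrix.re_trace_le {τ : Matrix n n ℂ} (hτ : IsDensityMatrix τ) (S : Matrix n n ℂ)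
    {a w : ℝ} (hw : 0 < w) :
    ((a : ℂ) • (τ * S) + (a : ℂ) • (Sᴴ * τ) - (w : ℂ) • (Sᴴ * τ * S)).trace.re ≤ a ^ 2 / w := by
  -- Completing the square: positivity of `(a/w - S)ᴴ τ (a/w - S)`, multiplied by `w`, is the claim.
  have hpos := (hτ.1.conjTranspose_mul_mul_same (((a / w : ℝ) : ℂ) • 1 - S)).trace_nonneg
  have hre := (Complex.le_def.mp hpos).1
  have hexp : (((a / w : ℝ) : ℂ) • (1 : Matrix n n ℂ) - S)ᴴ * τ * (((a / w : ℝ) : ℂ) • 1 - S) =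
      (((a / w) ^ 2 : ℝ) : ℂ) • τ - ((a / w : ℝ) : ℂ) • (τ * S) - ((a / w : ℝ) : ℂ) • (Sᴴ * τ) +
        Sᴴ * τ * S := by
    rw [conjTranspose_sub, conjTranspose_smul, conjTranspose_one, Complex.star_def,
      Complex.conj_ofReal]
    simp only [Matrix.sub_mul, Matrix.mul_sub, Matrix.smul_mul, Matrix.mul_smul, Matrix.one_mul,
      Matrix.mul_one, smul_sub, smul_smul]
    rw [pow_two, Complex.ofReal_mul]
    abel
  rw [hexp] at hre
  simp only [trace_add, trace_sub, trace_smul, smul_eq_mul, hτ.2, Complex.add_re, Complex.sub_re,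
    Complex.re_ofReal_mul, Complex.zero_re, Complex.one_re] at hre ⊢
  have h2 := mul_nonneg hw.le hre
  have e : w * ((a / w) ^ 2 * 1 - a / w * (τ * S).trace.re - a / w * (Sᴴ * τ).trace.re +
      (Sᴴ * τ * S).trace.re) = a ^ 2 / w - a * (τ * S).trace.re - a * (Sᴴ * τ).trace.re +
      w * (Sᴴ * τ * S).trace.re := by
    field_simp
  rw [e] at h2
  linarith

/-- Every reverse test of `(σ₀, σ₁)` has an `invDivergence` bounded below by a concave quadratic
functional of `(σ₀, σ₁)`. -/
lemma ExistsCPTP.re_trace_le_invDivergence {p₀ p₁ : X → ℝ} {σ₀ σ₁ : Matrix n n ℂ}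
    (h : ExistsCPTP p₀ p₁ σ₀ σ₁) (hp₀ : ∀ x, 0 ≤ p₀ x) (hp₁ : ∀ x, 0 ≤ p₁ x) {t : ℝ} (ht : 0 < t)
    (S : Matrix n n ℂ) :
    (σ₁ * S + Sᴴ * σ₁ - Sᴴ * (σ₀ + (t : ℂ) • σ₁) * S).trace.re ≤ invDivergence t p₀ p₁ := by
  obtain ⟨τ, hτ, rfl, rfl⟩ := existsCPTP_iff.mp h
  -- The functional is linear in `(σ₀, σ₁)`, so it splits into single-state terms with `a = p₁ x`
  -- and `w = p₀ x + t * p₁ x`.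
  have hsum : (∑ x, (p₁ x : ℂ) • τ x) * S + Sᴴ * (∑ x, (p₁ x : ℂ) • τ x) -
      Sᴴ * ((∑ x, (p₀ x : ℂ) • τ x) + (t : ℂ) • ∑ x, (p₁ x : ℂ) • τ x) * S =
      ∑ x, ((p₁ x : ℂ) • (τ x * S) + (p₁ x : ℂ) • (Sᴴ * τ x) -
        ((p₀ x + t * p₁ x : ℝ) : ℂ) • (Sᴴ * τ x * S)) := by
    simp only [Finset.smul_sum, Matrix.sum_mul, Matrix.mul_sum, ← Finset.sum_add_distrib,
      ← Finset.sum_sub_distrib]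
    refine Finset.sum_congr rfl fun x _ => ?_
    simp only [Matrix.smul_mul, Matrix.mul_smul, Matrix.mul_add, Matrix.add_mul, smul_smul,
      Complex.ofReal_add, Complex.ofReal_mul, add_smul]
  rw [hsum, trace_sum, Complex.re_sum, invDivergence]
  refine Finset.sum_le_sum fun x _ => ?_
  have hnonneg : 0 ≤ p₀ x + t * p₁ x := add_nonneg (hp₀ x) (mul_nonneg ht.le (hp₁ x))
  rcases hnonneg.eq_or_lt with h0 | hpos
  · have h1 : p₁ x = 0 := by
      have := mul_nonneg ht.le (hp₁ x)
      have h2 : t * p₁ x = 0 := by linarith [hp₀ x]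
      exact (mul_eq_zero.mp h2).resolve_left ht.ne'
    rw [← h0, h1]; simp
  · exact (hτ x).re_trace_le S hpos

lemma mul_diagonal_mul_conjTranspose_eq_sum (V : Matrix n n ℂ) (d : n → ℂ) :
    V * diagonal d * Vᴴ = ∑ j, d j • vecMulVec (fun i => V i j) (star fun i => V i j) := by
  ext a b
  rw [Matrix.mul_apply, Matrix.sum_apply]
  refine Finset.sum_congr rfl fun j _ => ?_
  rw [Matrix.mul_diagonal, Matrix.smul_apply, vecMulVec_apply, conjTranspose_apply, smul_eq_mul,
    Pi.star_apply]
  ring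

lemma trace_vecMulVec_self_star {n : Type*} [Fintype n] (v : n → ℂ) :
    (vecMulVec v (star v)).trace = ((∑ i, Complex.normSq (v i) : ℝ) : ℂ) := by
  rw [trace_vecMulVec, dotProduct, Complex.ofReal_sum]
  refine Finset.sum_congr rfl fun i _ => ?_
  rw [Pi.star_apply, Complex.star_def, Complex.mul_conj]

/-- There is a reverse test that minimizes `invDivergence t` for all `t > 0` at once. -/
lemma exists_minimal_reverseTest {σ₀ σ₁ : Matrix n n ℂ} (hσ₀ : IsDensityMatrix σ₀)
    (hσ₁ : IsDensityMatrix σ₁) :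
    ∃ q₀ q₁ : n → ℝ, q₀ ∈ stdSimplex ℝ n ∧ q₁ ∈ stdSimplex ℝ n ∧ ExistsCPTP q₀ q₁ σ₀ σ₁ ∧
      ∀ t : ℝ, 0 < t → ∀ (k : ℕ) (p₀ p₁ : Fin k → ℝ), (∀ x, 0 ≤ p₀ x) → (∀ x, 0 ≤ p₁ x) →
        ExistsCPTP p₀ p₁ σ₀ σ₁ → invDivergence t q₀ q₁ ≤ invDivergence t p₀ p₁ := by
  obtain ⟨V, W, c, hc0, hc1, h₀, h₁, hE, hEc⟩ :=
    exists_simultaneous_diagonalization hσ₀.1 hσ₁.1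
  set m : n → ℝ := fun j => ∑ i, Complex.normSq (V i j) with hm
  have hm0 : ∀ j, 0 ≤ m j := fun j => Finset.sum_nonneg fun i _ => Complex.normSq_nonneg _
  have htrace : ∀ d : n → ℝ,
      (V * diagonal (fun j => (d j : ℂ)) * Vᴴ).trace = ((∑ j, d j * m j : ℝ) : ℂ) := by
    intro d
    rw [mul_diagonal_mul_conjTranspose_eq_sum, trace_sum, Complex.ofReal_sum]
    refine Finset.sum_congr rfl fun j _ => ?_
    rw [trace_smul, trace_vecMulVec_self_star, smul_eq_mul, Complex.ofReal_mul]
  -- Normalized rank-one projections onto the columns of `V`. A zero column gets weight zero, so any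
  -- state serves there.
  let τ : n → Matrix n n ℂ := fun j => if m j = 0 then σ₀ else
    ((m j : ℂ))⁻¹ • vecMulVec (fun i => V i j) (star fun i => V i j)
  have hmτ : ∀ j, (m j : ℂ) • τ j = vecMulVec (fun i => V i j) (star fun i => V i j) := by
    intro j
    by_cases hj : m j = 0
    · have hv : (fun i => V i j) = 0 := by
        ext i
        exact Complex.normSq_eq_zero.mp
          ((Finset.sum_eq_zero_iff_of_nonneg fun i _ => Complex.normSq_nonneg _).mp hj i
            (Finset.mem_univ i))
      rw [hj, hv]; simp
    · simp only [τ, if_neg hj, smul_smul]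
      rw [mul_inv_cancel₀ (by exact_mod_cast hj), one_smul]
  have hτ : ∀ j, IsDensityMatrix (τ j) := by
    intro j
    by_cases hj : m j = 0
    · simpa only [τ, if_pos hj] using hσ₀
    · simp only [τ, if_neg hj]
      refine ⟨(posSemidef_vecMulVec_self_star _).smul ?_, ?_⟩
      · rw [← Complex.ofReal_inv, Complex.zero_le_real]
        exact inv_nonneg.mpr (hm0 j)
      · rw [trace_smul, trace_vecMulVec_self_star, smul_eq_mul]
        exact inv_mul_cancel₀ (by exact_mod_cast hj)
  have hmix : ∀ d : n → ℝ, ∑ j, ((d j * m j : ℝ) : ℂ) • τ j =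
      V * diagonal (fun j => (d j : ℂ)) * Vᴴ := by
    intro d
    rw [mul_diagonal_mul_conjTranspose_eq_sum]
    refine Finset.sum_congr rfl fun j _ => ?_
    rw [Complex.ofReal_mul, mul_smul, hmτ]
  refine ⟨fun j => (1 - c j) * m j, fun j => c j * m j, ⟨?_, ?_⟩, ⟨?_, ?_⟩, ?_, ?_⟩
  · exact fun j => mul_nonneg (sub_nonneg.mpr (hc1 j)) (hm0 j)
  · have := htrace fun j => 1 - c j
    rw [← h₀, hσ₀.2] at this
    exact_mod_cast this.symm
  · exact fun j => mul_nonneg (hc0 j) (hm0 j)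
  · have := htrace c
    rw [← h₁, hσ₁.2] at this
    exact_mod_cast this.symm
  · refine existsCPTP_iff.mpr ⟨τ, hτ, ?_, ?_⟩
    · rw [hmix fun j => 1 - c j, ← h₀]
    · rw [hmix c, ← h₁]
  · intro t ht k p₀ p₁ hp₀ hp₁ hp
    have hK : ∀ j, 0 < 1 - c j + t * c j := by
      intro j
      rcases (hc0 j).eq_or_lt with h | h
      · rw [← h]; norm_num
      · have := mul_pos ht h
        linarith [hc1 j]
    set E := W * V with hEdef
    set C : Matrix n n ℂ := diagonal fun j => (c j : ℂ) with hC
    set G : Matrix n n ℂ := diagonal fun j => ((1 - c j + t * c j : ℝ) : ℂ)⁻¹ with hG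
    set K : Matrix n n ℂ := diagonal fun j => ((1 - c j + t * c j : ℝ) : ℂ) with hKdef
    have hCh : Cᴴ = C := by
      rw [hC, diagonal_conjTranspose]; congr 1; ext j; simp
    have hCE : C * E = C := by
      have h := congrArg conjTranspose hEc
      rwa [conjTranspose_mul, hE, hCh] at h
    have hGh : Gᴴ = G := by
      rw [hG, diagonal_conjTranspose]; congr 1; ext j; simp
    have hGK : G * K = 1 := by
      rw [hG, hKdef, diagonal_mul_diagonal, ← diagonal_one]
      congr 1; ext j
      exact inv_mul_cancel₀ (by exact_mod_cast (hK j).ne')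
    have hCG : C * G = G * C := by
      rw [hC, hG, diagonal_mul_diagonal, diagonal_mul_diagonal]
      congr 1; ext j; ring
    have hσK : σ₀ + (t : ℂ) • σ₁ = V * K * Vᴴ := by
      conv_lhs => rw [h₀, h₁]
      rw [← Matrix.smul_mul, ← Matrix.mul_smul, ← Matrix.add_mul, ← Matrix.mul_add, hC,
        ← diagonal_smul, diagonal_add]
      congr 3; ext j; simp
    have hEh : Vᴴ * Wᴴ = E := by rw [← conjTranspose_mul, hE]
    -- The optimal `S` is formally `(σ₀ + t σ₁)⁻¹ σ₁`, with `W` in place of `V⁻¹` and `G = K⁻¹`. For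
    -- it the three terms of the functional coincide, each being `V (C G C) Vᴴ`.
    have hle := hp.re_trace_le_invDivergence hp₀ hp₁ ht (Wᴴ * (C * G) * Vᴴ)
    have hSh : (Wᴴ * (C * G) * Vᴴ)ᴴ = V * (G * C) * W := by
      simp only [conjTranspose_mul, conjTranspose_conjTranspose, hCh, hGh]
      simp only [Matrix.mul_assoc]
    have e₁ : σ₁ * (Wᴴ * (C * G) * Vᴴ) = V * (C * G * C) * Vᴴ := by
      calc σ₁ * (Wᴴ * (C * G) * Vᴴ) = V * (C * (Vᴴ * Wᴴ)) * (C * G) * Vᴴ := by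
            rw [h₁]; simp only [Matrix.mul_assoc]
        _ = V * (C * G * C) * Vᴴ := by
            rw [hEh, hCE, Matrix.mul_assoc C G C, ← hCG]; simp only [Matrix.mul_assoc]
    have e₂ : V * (G * C) * W * σ₁ = V * (C * G * C) * Vᴴ := by
      calc V * (G * C) * W * σ₁ = V * (G * C) * (W * V * C) * Vᴴ := by
            rw [h₁]; simp only [Matrix.mul_assoc]
        _ = V * (C * G * C) * Vᴴ := by
            rw [← hEdef, hEc, hCG]; simp only [Matrix.mul_assoc]
    have e₃ : V * (G * C) * W * (σ₀ + (t : ℂ) • σ₁) * (Wᴴ * (C * G) * Vᴴ) =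
        V * (C * G * C) * Vᴴ := by
      calc V * (G * C) * W * (σ₀ + (t : ℂ) • σ₁) * (Wᴴ * (C * G) * Vᴴ)
          = V * G * (C * (W * V)) * K * ((Vᴴ * Wᴴ) * C) * G * Vᴴ := by
            rw [hσK]; simp only [Matrix.mul_assoc]
        _ = V * (G * C) * K * (C * G) * Vᴴ := by
            rw [hEh, ← hEdef, hEc, hCE]; simp only [Matrix.mul_assoc]
        _ = V * (C * (G * K) * (G * C)) * Vᴴ := by
            rw [← hCG]; simp only [Matrix.mul_assoc]
        _ = _ := by rw [hGK, Matrix.mul_one, Matrix.mul_assoc C]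
    have hCGC : C * G * C =
        diagonal fun j => ((c j ^ 2 / (1 - c j + t * c j) : ℝ) : ℂ) := by
      rw [hC, hG, diagonal_mul_diagonal, diagonal_mul_diagonal]
      congr 1; ext j
      push_cast
      ring
    rw [hSh, e₁, e₂, e₃, add_sub_cancel_right, hCGC, htrace, Complex.ofReal_re] at hle
    refine le_of_eq_of_le ?_ hle
    refine Finset.sum_congr rfl fun j _ => ?_
    rcases eq_or_ne (m j) 0 with hj | hj
    · simp [hj]
    · have := (hK j).ne'
      have e : (1 - c j) * m j + t * (c j * m j) = (1 - c j + t * c j) * m j := by ring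
      rw [e, mul_pow]
      field_simp

end MinimalReverseTest

/-! ### The law of the likelihood ratio -/

section Classical

/-- Linear independence of the functions `u ↦ c ^ 2 / (1 + u * c)`, `c ≠ 0`. -/
lemma eq_zero_of_sum_sq_div_eq_zero (F : Finset ℝ) (d : ℝ → ℝ) (hF : ∀ c ∈ F, 0 ≤ c)
    (h : ∀ u : ℝ, 0 < u → ∑ c ∈ F, d c * (c ^ 2 / (1 + u * c)) = 0) {a : ℝ} (ha : a ∈ F)
    (ha0 : a ≠ 0) : d a = 0 := by
  -- The relation multiplied by the common denominator `∏ (1 + u * c)`. It vanishes for all `u > 0`,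
  -- hence identically.
  let P : Polynomial ℝ := ∑ c ∈ F, Polynomial.C (d c * c ^ 2) *
    ∏ b ∈ F.erase c, (1 + Polynomial.X * Polynomial.C b)
  have heval : ∀ u, P.eval u = ∑ c ∈ F, d c * c ^ 2 * ∏ b ∈ F.erase c, (1 + u * b) := by
    intro u
    simp [P, Polynomial.eval_finsetSum, Polynomial.eval_prod, mul_comm u]
  have hP : P = 0 := by
    refine Polynomial.eq_zero_of_infinite_isRoot P ((Set.Ioi_infinite (0 : ℝ)).mono ?_)
    intro u hu
    rw [Set.mem_Ioi] at hu
    rw [Set.mem_ofPred_eq, Polynomial.IsRoot, heval, ← mul_zero (∏ b ∈ F, (1 + u * b)), ← h u hu,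
      Finset.mul_sum]
    refine Finset.sum_congr rfl fun c hc => ?_
    have hpos : 1 + u * c ≠ 0 := by
      have := mul_nonneg hu.le (hF c hc)
      linarith
    rw [← Finset.mul_prod_erase F _ hc]
    calc d c * c ^ 2 * ∏ b ∈ F.erase c, (1 + u * b)
        = (∏ b ∈ F.erase c, (1 + u * b)) * (d c * c ^ 2) * ((1 + u * c) / (1 + u * c)) := by
          rw [div_self hpos]; ring
      _ = _ := by ring
  -- At the pole `u = -a⁻¹` of the `a`-term, every other summand contains the factor `1 + u * a =
  -- 0`.
  have hroot := heval (-a⁻¹)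
  rw [hP, Polynomial.eval_zero, Finset.sum_eq_single a] at hroot
  · have hprod : ∏ b ∈ F.erase a, (1 + -a⁻¹ * b) ≠ 0 := by
      rw [Finset.prod_ne_zero_iff]
      intro b hb hb0
      apply Finset.ne_of_mem_erase hb
      field_simp at hb0
      linarith
    have := (mul_eq_zero.mp hroot.symm).resolve_right hprod
    exact (mul_eq_zero.mp this).resolve_right (pow_ne_zero 2 ha0)
  · intro c _ hca
    rw [Finset.prod_eq_zero (Finset.mem_erase.mpr ⟨hca.symm, ha⟩), mul_zero]
    rw [neg_mul, inv_mul_cancel₀ ha0, add_neg_cancel]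
  · exact fun hn => absurd ha hn

variable {X Y : Type*} [Fintype X] [Fintype Y]

/-- The likelihood ratio `p₁ / (p₀ + p₁)`. -/
noncomputable def likelihood {X : Type*} (p₀ p₁ : X → ℝ) (x : X) : ℝ := p₁ x / (p₀ x + p₁ x)

section Likelihood

variable {Z : Type*} {p₀ p₁ : Z → ℝ}

lemma likelihood_mul (h₀ : ∀ x, 0 ≤ p₀ x) (h₁ : ∀ x, 0 ≤ p₁ x) (x : Z) :
    likelihood p₀ p₁ x * (p₀ x + p₁ x) = p₁ x := by
  rw [likelihood]
  rcases eq_or_ne (p₀ x + p₁ x) 0 with h | h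
  · have : p₁ x = 0 := by linarith [h₀ x, h₁ x]
    rw [h, this]; simp
  · exact div_mul_cancel₀ _ h

lemma one_sub_likelihood_mul (h₀ : ∀ x, 0 ≤ p₀ x) (h₁ : ∀ x, 0 ≤ p₁ x) (x : Z) :
    (1 - likelihood p₀ p₁ x) * (p₀ x + p₁ x) = p₀ x := by
  rw [sub_mul, likelihood_mul h₀ h₁]; ring

lemma likelihood_nonneg (h₀ : ∀ x, 0 ≤ p₀ x) (h₁ : ∀ x, 0 ≤ p₁ x) (x : Z) :
    0 ≤ likelihood p₀ p₁ x :=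
  div_nonneg (h₁ x) (add_nonneg (h₀ x) (h₁ x))

end Likelihood

/-- The mass that `p₀ + p₁` gives to the level set of the likelihood ratio at `c`. -/
noncomputable def levelMass {X : Type*} [Fintype X] (p₀ p₁ : X → ℝ) (c : ℝ) : ℝ :=
  ∑ x with likelihood p₀ p₁ x = c, (p₀ x + p₁ x)

lemma sum_levelMass_mul {p₀ p₁ : X → ℝ} (F : Finset ℝ) (hF : ∀ x, likelihood p₀ p₁ x ∈ F)
    (g : ℝ → ℝ) :
    ∑ c ∈ F, levelMass p₀ p₁ c * g c = ∑ x, (p₀ x + p₁ x) * g (likelihood p₀ p₁ x) := by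
  rw [← Finset.sum_fiberwise_of_maps_to (fun x _ => hF x)]
  refine Finset.sum_congr rfl fun c _ => ?_
  rw [levelMass, Finset.sum_mul]
  refine Finset.sum_congr rfl fun x hx => ?_
  rw [(Finset.mem_filter.mp hx).2]

/-- The shift `t = 1 + u` matches the normalization by `p₀ + p₁`: with `l` the likelihood ratio, `p₀
+ (1 + u) p₁ = (1 + u l) (p₀ + p₁)`. -/
lemma invDivergence_eq_sum_likelihood {p₀ p₁ : X → ℝ} (h₀ : ∀ x, 0 ≤ p₀ x) (h₁ : ∀ x, 0 ≤ p₁ x)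
    (u : ℝ) : invDivergence (1 + u) p₀ p₁ = ∑ x, (p₀ x + p₁ x) *
      (likelihood p₀ p₁ x ^ 2 / (1 + u * likelihood p₀ p₁ x)) := by
  refine Finset.sum_congr rfl fun x _ => ?_
  rcases eq_or_ne (p₀ x + p₁ x) 0 with h | h
  · have : p₁ x = 0 := by linarith [h₀ x, h₁ x]
    rw [h, this]; simp
  · have hl := likelihood_mul h₀ h₁ x
    have e : p₀ x + (1 + u) * p₁ x = (1 + u * likelihood p₀ p₁ x) * (p₀ x + p₁ x) := by
      linear_combination (-u) * hl
    rw [e]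
    nth_rewrite 1 [← hl]
    field_simp

/-- The values of `invDivergence` determine the law of the likelihood ratio. -/
lemma levelMass_eq_of_invDivergence_eq {p₀ p₁ : X → ℝ} {q₀ q₁ : Y → ℝ}
    (hp₀ : p₀ ∈ stdSimplex ℝ X) (hp₁ : p₁ ∈ stdSimplex ℝ X) (hq₀ : q₀ ∈ stdSimplex ℝ Y)
    (hq₁ : q₁ ∈ stdSimplex ℝ Y)
    (h : ∀ t : ℝ, 0 < t → invDivergence t p₀ p₁ = invDivergence t q₀ q₁) (c : ℝ) :
    levelMass p₀ p₁ c = levelMass q₀ q₁ c := by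
  classical
  let F : Finset ℝ := insert 0 (insert c
    (Finset.univ.image (likelihood p₀ p₁) ∪ Finset.univ.image (likelihood q₀ q₁)))
  let d : ℝ → ℝ := fun a => levelMass p₀ p₁ a - levelMass q₀ q₁ a
  have hFp : ∀ x, likelihood p₀ p₁ x ∈ F := fun x => by simp [F]
  have hFq : ∀ x, likelihood q₀ q₁ x ∈ F := fun x => by simp [F]
  have hd : ∀ g : ℝ → ℝ, ∑ a ∈ F, d a * g a =
      ∑ x, (p₀ x + p₁ x) * g (likelihood p₀ p₁ x) -
        ∑ y, (q₀ y + q₁ y) * g (likelihood q₀ q₁ y) := by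
    intro g
    rw [← sum_levelMass_mul F hFp, ← sum_levelMass_mul F hFq, ← Finset.sum_sub_distrib]
    exact Finset.sum_congr rfl fun a _ => sub_mul _ _ _
  have hneg : ∀ a, ¬ 0 ≤ a → d a = 0 := by
    intro a ha
    have hp : levelMass p₀ p₁ a = 0 := Finset.sum_eq_zero fun x hx =>
      absurd ((Finset.mem_filter.mp hx).2 ▸ likelihood_nonneg hp₀.1 hp₁.1 x) ha
    have hq : levelMass q₀ q₁ a = 0 := Finset.sum_eq_zero fun x hx =>
      absurd ((Finset.mem_filter.mp hx).2 ▸ likelihood_nonneg hq₀.1 hq₁.1 x) ha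
    simp only [d, hp, hq, sub_self]
  have hne : ∀ a ∈ F, a ≠ 0 → d a = 0 := by
    intro a haF ha
    by_cases hapos : 0 ≤ a
    · refine eq_zero_of_sum_sq_div_eq_zero (F.filter (0 ≤ ·)) d
        (fun b hb => (Finset.mem_filter.mp hb).2) (fun u hu => ?_)
        (Finset.mem_filter.mpr ⟨haF, hapos⟩) ha
      rw [Finset.sum_filter_of_ne, hd fun a => a ^ 2 / (1 + u * a),
        ← invDivergence_eq_sum_likelihood hp₀.1 hp₁.1, ← invDivergence_eq_sum_likelihood hq₀.1 hq₁.1,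
        h _ (by linarith), sub_self]
      intro b _ hb
      by_contra hb'
      exact hb (by rw [hneg b hb', zero_mul])
    · exact hneg a hapos
  -- The functions `c ^ 2 / (1 + u * c)` do not see the level `0`; its mass is recovered from the
  -- equality of total masses.
  have hzero : d 0 = 0 := by
    have h1 := hd fun _ => 1
    simp only [mul_one, Finset.sum_add_distrib] at h1
    rw [hp₀.2, hp₁.2, hq₀.2, hq₁.2, sub_self, Finset.sum_eq_single 0 hne] at h1
    · exact h1
    · exact fun hn => absurd (Finset.mem_insert_self _ _) hn
  rw [← sub_eq_zero]
  by_cases hc : c = 0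
  · rw [hc]; exact hzero
  · exact hne c (by simp [F]) hc

end Classical

/-! ### Sufficiency of the likelihood ratio -/

section Transfer

variable {X Y n : Type*} [Fintype X] [DecidableEq X] [Fintype Y] [DecidableEq Y] [Fintype n]
  [DecidableEq n]

/-- If the likelihood ratios of two pairs of densities have the same law, then whatever can be
prepared from one pair can be prepared from the other. -/
lemma ExistsCPTP.of_levelMass_eq {p₀ p₁ : X → ℝ} {q₀ q₁ : Y → ℝ} {σ₀ σ₁ : Matrix n n ℂ}
    (hp₀ : ∀ x, 0 ≤ p₀ x) (hp₁ : ∀ x, 0 ≤ p₁ x) (hq₀ : ∀ y, 0 ≤ q₀ y) (hq₁ : ∀ y, 0 ≤ q₁ y)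
    (hσ : IsDensityMatrix σ₀) (hmass : ∀ c, levelMass p₀ p₁ c = levelMass q₀ q₁ c)
    (h : ExistsCPTP q₀ q₁ σ₀ σ₁) : ExistsCPTP p₀ p₁ σ₀ σ₁ := by
  obtain ⟨τ, hτ, h₀, h₁⟩ := existsCPTP_iff.mp h
  set l := likelihood p₀ p₁ with hl
  set l' := likelihood q₀ q₁ with hl'
  set M := levelMass q₀ q₁ with hM
  have hM0 : ∀ c, 0 ≤ M c := fun c => Finset.sum_nonneg fun y _ => add_nonneg (hq₀ y) (hq₁ y)
  -- The conditional expectation of `τ` under `q₀ + q₁`, given that the likelihood ratio equals `l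
  -- x`. If that level has no mass, then `x` has none either and any state serves.
  let ω : X → Matrix n n ℂ := fun x => if M (l x) = 0 then σ₀ else
    ((M (l x) : ℂ))⁻¹ • ∑ y with l' y = l x, ((q₀ y + q₁ y : ℝ) : ℂ) • τ y
  have hω : ∀ x, IsDensityMatrix (ω x) := by
    intro x
    by_cases hx : M (l x) = 0
    · simpa only [ω, if_pos hx] using hσ
    · simp only [ω, if_neg hx]
      refine ⟨(Matrix.posSemidef_sum _ fun y _ => (hτ y).1.smul ?_).smul ?_, ?_⟩
      · rw [Complex.zero_le_real]; exact add_nonneg (hq₀ y) (hq₁ y)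
      · rw [← Complex.ofReal_inv, Complex.zero_le_real]; exact inv_nonneg.mpr (hM0 _)
      · rw [Matrix.trace_smul, Matrix.trace_sum]
        simp_rw [Matrix.trace_smul, (hτ _).2, smul_eq_mul, mul_one]
        rw [← Complex.ofReal_sum]
        exact inv_mul_cancel₀ (by exact_mod_cast hx)
  -- Mixtures agree for every weight that depends only on the likelihood ratio; `w c = 1 - c` and `w
  -- c = c` give the two states.
  have hmix : ∀ w : ℝ → ℝ, ∑ x, ((w (l x) * (p₀ x + p₁ x) : ℝ) : ℂ) • ω x =
      ∑ y, ((w (l' y) * (q₀ y + q₁ y) : ℝ) : ℂ) • τ y := by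
    intro w
    have hx : ∀ x, ((w (l x) * (p₀ x + p₁ x) : ℝ) : ℂ) • ω x = ∑ y,
        if l x = l' y then ((w (l' y) * (q₀ y + q₁ y) / M (l' y) * (p₀ x + p₁ x) : ℝ) : ℂ) • τ y
          else 0 := by
      intro x
      by_cases hx : M (l x) = 0
      · have hpx : p₀ x + p₁ x = 0 := by
          rw [← hmass] at hx
          exact (Finset.sum_eq_zero_iff_of_nonneg fun z _ => add_nonneg (hp₀ z) (hp₁ z)).mp hx x
            (by simp [hl])
        rw [hpx]; simp
      · simp only [ω, if_neg hx, Finset.smul_sum, smul_smul]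
        rw [Finset.sum_filter]
        refine Finset.sum_congr rfl fun y _ => ?_
        by_cases hy : l' y = l x
        · rw [if_pos hy, if_pos hy.symm, hy]
          congr 1
          push_cast
          ring
        · rw [if_neg hy, if_neg (Ne.symm hy)]
    simp_rw [hx]
    rw [Finset.sum_comm]
    refine Finset.sum_congr rfl fun y _ => ?_
    rw [← Finset.sum_filter, ← Finset.sum_smul]
    congr 1
    rw [← Complex.ofReal_sum, ← Finset.mul_sum]
    congr 1
    have hMy : ∑ x with l x = l' y, (p₀ x + p₁ x) = M (l' y) := hmass (l' y)
    rw [hMy]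
    rcases eq_or_ne (M (l' y)) 0 with hy | hy
    · have hqy : q₀ y + q₁ y = 0 :=
        (Finset.sum_eq_zero_iff_of_nonneg fun z _ => add_nonneg (hq₀ z) (hq₁ z)).mp hy y
          (by simp [hl'])
      rw [hqy]; simp
    · exact div_mul_cancel₀ _ hy
  refine existsCPTP_iff.mpr ⟨ω, hω, ?_, ?_⟩
  · have := hmix fun c => 1 - c
    simp only [hl, hl', one_sub_likelihood_mul hp₀ hp₁, one_sub_likelihood_mul hq₀ hq₁] at this
    rw [this, h₀]
  · have := hmix fun c => c
    simp only [hl, hl', likelihood_mul hp₀ hp₁, likelihood_mul hq₀ hq₁] at this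
    rw [this, h₁]

end Transfer

/-! ### Operator convexity of the shifted inverse -/

section OperatorConvexity

open Matrix

/-- For `A ≥ 0` and `t > 0`, the functional calculus gives `(t + A)⁻¹`. -/
lemma cfc_inv_add_properties {m : ℕ} {t : ℝ} (ht : 0 < t) {A : Matrix (Fin m) (Fin m) ℂ}
    (hA : 0 ≤ A) :
    (cfc (fun x : ℝ => (t + x)⁻¹) A)ᴴ = cfc (fun x : ℝ => (t + x)⁻¹) A ∧
      (t • 1 + A) * cfc (fun x : ℝ => (t + x)⁻¹) A = 1 := by
  have hsa : IsSelfAdjoint A := IsSelfAdjoint.of_nonneg hA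
  have hspec : ∀ x ∈ spectrum ℝ A, t + x ≠ 0 := by
    intro x hx
    have := spectrum_nonneg_of_nonneg hA hx
    linarith
  have hcont : ContinuousOn (fun x : ℝ => (t + x)⁻¹) (spectrum ℝ A) :=
    ContinuousOn.inv₀ (by fun_prop) hspec
  refine ⟨cfc_predicate (fun x : ℝ => (t + x)⁻¹) A, ?_⟩
  have h1 : cfc (fun x : ℝ => t + x) A = t • 1 + A := by
    rw [cfc_const_add t (fun x : ℝ => x) A, cfc_id' ℝ A, Algebra.algebraMap_eq_smul_one]
  rw [← h1, ← cfc_mul (fun x : ℝ => t + x) (fun x : ℝ => (t + x)⁻¹) A (by fun_prop) hcont,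
    ← cfc_one ℝ A]
  exact cfc_congr fun x hx => mul_inv_cancel₀ (hspec x hx)

/-- The variational inequality `S + Sᴴ - Sᴴ B S ≤ B⁻¹` for positive definite `B`. -/
lemma add_conjTranspose_sub_le_of_mul_eq_one {n : Type*} [Fintype n] [DecidableEq n]
    {B G : Matrix n n ℂ} (hB : B.PosSemidef) (hG : Gᴴ = G) (hBG : B * G = 1) (S : Matrix n n ℂ) :
    S + Sᴴ - Sᴴ * B * S ≤ G := by
  rw [le_iff]
  have h := hB.conjTranspose_mul_mul_same (G - S)
  have hGB : G * B = 1 := by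
    have := congrArg conjTranspose hBG
    rwa [conjTranspose_mul, hG, hB.1.eq, conjTranspose_one] at this
  have e : (G - S)ᴴ * B * (G - S) = G - (S + Sᴴ - Sᴴ * B * S) := by
    rw [conjTranspose_sub, hG, Matrix.sub_mul, hGB, Matrix.mul_sub, Matrix.sub_mul, Matrix.sub_mul,
      Matrix.one_mul, Matrix.one_mul, Matrix.mul_assoc Sᴴ B G, hBG, Matrix.mul_one]
    abel
  rwa [e] at h

/-- `(t + A)⁻¹` is the maximum over `S` of `S + Sᴴ - Sᴴ (t + A) S`, which is affine in `A`. The `S`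
optimal at the convex combination is used as a competitor at both endpoints. -/
lemma operatorConvex_inv_add {t : ℝ} (ht : 0 < t) : OperatorConvex fun x => (t + x)⁻¹ := by
  intro m
  have hconv : Convex ℝ {A : Matrix (Fin m) (Fin m) ℂ | 0 ≤ A} := by
    intro A hA B hB a b ha hb _
    rw [Set.mem_ofPred_eq] at hA hB ⊢
    exact add_nonneg (smul_nonneg ha hA) (smul_nonneg hb hB)
  refine ⟨hconv, ?_⟩
  intro A hA B hB a b ha hb hab
  have hpos : ∀ C : Matrix (Fin m) (Fin m) ℂ, 0 ≤ C → (t • 1 + C).PosSemidef := by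
    intro C hC
    rw [← nonneg_iff_posSemidef]
    exact add_nonneg (smul_nonneg ht.le (nonneg_iff_posSemidef.mpr PosSemidef.one)) hC
  obtain ⟨hSh, hS⟩ := cfc_inv_add_properties ht (hconv hA hB ha hb hab)
  obtain ⟨hAh, hAi⟩ := cfc_inv_add_properties ht hA
  obtain ⟨hBh, hBi⟩ := cfc_inv_add_properties ht hB
  set S := cfc (fun x : ℝ => (t + x)⁻¹) (a • A + b • B) with hSdef
  have iA := add_conjTranspose_sub_le_of_mul_eq_one (hpos A hA) hAh hAi S
  have iB := add_conjTranspose_sub_le_of_mul_eq_one (hpos B hB) hBh hBi S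
  have key : S = a • (S + Sᴴ - Sᴴ * (t • 1 + A) * S) + b • (S + Sᴴ - Sᴴ * (t • 1 + B) * S) := by
    have e : Sᴴ * (t • 1 + (a • A + b • B)) * S = Sᴴ := by
      rw [Matrix.mul_assoc, hS, Matrix.mul_one]
    have ht1 : t • (1 : Matrix (Fin m) (Fin m) ℂ) = a • t • 1 + b • t • 1 := by
      rw [← add_smul, hab, one_smul]
    have e2 : t • 1 + (a • A + b • B) = a • (t • 1 + A) + b • (t • 1 + B) := by
      rw [smul_add, smul_add]
      nth_rewrite 1 [ht1]
      abel
    rw [e2, Matrix.mul_add, Matrix.add_mul, Matrix.mul_smul, Matrix.mul_smul, Matrix.smul_mul,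
      Matrix.smul_mul] at e
    have e3 : a • (S + Sᴴ) + b • (S + Sᴴ) = S + Sᴴ := by rw [← add_smul, hab, one_smul]
    rw [smul_sub, smul_sub, sub_add_sub_comm, e3, e, add_sub_cancel_right]
  calc S = _ := key
    _ ≤ _ := add_le_add (smul_le_smul_of_nonneg_left iA ha) (smul_le_smul_of_nonneg_left iB hb)

end OperatorConvexity

/-! ### From extended-real divergences to `invDivergence` -/

section Divergence

lemma EReal.coe_finsetSum {ι : Type*} (s : Finset ι) (g : ι → ℝ) :
    ((∑ i ∈ s, g i : ℝ) : EReal) = ∑ i ∈ s, (g i : EReal) :=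
  map_sum (⟨⟨Real.toEReal, rfl⟩, EReal.coe_add⟩ : ℝ →+ EReal) g s

lemma slopeAtTop_eq_zero_of_eq_inv {f : ℝ → EReal} {t : ℝ}
    (hf : ∀ x, 0 ≤ x → f x = (((t + x)⁻¹ : ℝ) : EReal)) : slopeAtTop f = 0 := by
  refine Filter.Tendsto.limsup_eq ?_
  have h : Filter.Tendsto (fun x : ℝ => (((t + x)⁻¹ / x : ℝ) : EReal)) Filter.atTop
      (nhds ((0 : ℝ) : EReal)) := by
    refine (continuous_coe_real_ereal.tendsto 0).comp ?_
    have h1 : Filter.Tendsto (fun x : ℝ => (t + x)⁻¹) Filter.atTop (nhds 0) :=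
      Filter.Tendsto.inv_tendsto_atTop (Filter.tendsto_atTop_add_const_left _ t Filter.tendsto_id)
    simpa [div_eq_mul_inv] using h1.mul tendsto_inv_atTop_zero
  rw [EReal.coe_zero] at h
  refine h.congr' ?_
  filter_upwards [Filter.eventually_ge_atTop 0] with x hx
  rw [hf x hx, EReal.coe_div]

/-- Points with `p₁ x = 0` contribute nothing on either side: the slope of `f` at infinity is zero,
and so is the numerator `p₁ x ^ 2`. Prescribing `f` only on `[0, ∞)` lets the lemma apply to
`invShift t` as well. -/
lemma fDivergence_eq_invDivergence {X : Type*} [Fintype X] {f : ℝ → EReal} {t : ℝ} (ht : 0 < t)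
    (hf : ∀ x, 0 ≤ x → f x = (((t + x)⁻¹ : ℝ) : EReal)) {p₀ p₁ : X → ℝ} (h₀ : ∀ x, 0 ≤ p₀ x)
    (h₁ : ∀ x, 0 ≤ p₁ x) : fDivergence f p₀ p₁ = (invDivergence t p₀ p₁ : EReal) := by
  rw [fDivergence, slopeAtTop_eq_zero_of_eq_inv hf, mul_zero, add_zero]
  have h : ∀ x, p₁ x ≠ 0 → (p₁ x : EReal) * f (p₀ x / p₁ x) =
      ((p₁ x ^ 2 / (p₀ x + t * p₁ x) : ℝ) : EReal) := by
    intro x hx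
    have hx' : 0 < p₁ x := lt_of_le_of_ne (h₁ x) hx.symm
    rw [hf _ (div_nonneg (h₀ x) (h₁ x)), ← EReal.coe_mul]
    congr 1
    have h2 : 0 < p₀ x + t * p₁ x := add_pos_of_nonneg_of_pos (h₀ x) (mul_pos ht hx')
    have h3 : t + p₀ x / p₁ x = (p₀ x + t * p₁ x) / p₁ x := by field_simp; ring
    rw [h3, inv_div]
    ring
  rw [Finset.sum_congr rfl fun x hx => h x (Finset.mem_filter.mp hx).2, ← EReal.coe_finsetSum,
    invDivergence, Finset.sum_filter_of_ne]
  intro x _ hne hx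
  exact hne (by simp [hx])

lemma invDivergence_comp_equiv {X Y : Type*} [Fintype X] [Fintype Y] (t : ℝ) (p₀ p₁ : X → ℝ)
    (e : Y ≃ X) : invDivergence t (p₀ ∘ e) (p₁ ∘ e) = invDivergence t p₀ p₁ :=
  e.sum_comp fun x => p₁ x ^ 2 / (p₀ x + t * p₁ x)

lemma comp_equiv_mem_stdSimplex {X Y : Type*} [Fintype X] [Fintype Y] {p : X → ℝ}
    (hp : p ∈ stdSimplex ℝ X) (e : Y ≃ X) : p ∘ e ∈ stdSimplex ℝ Y :=
  ⟨fun y => hp.1 (e y), (e.sum_comp p).trans hp.2⟩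

variable {X n : Type*} [Fintype X] [DecidableEq X] [Fintype n] [DecidableEq n]

/-- The reverse test problem is decided by the maximal divergences of `x ↦ (t + x)⁻¹`, `t > 0`. -/
lemma existsCPTP_of_fDivergence_eq {p₀ p₁ : X → ℝ} (hp₀ : p₀ ∈ stdSimplex ℝ X)
    (hp₁ : p₁ ∈ stdSimplex ℝ X) {σ₀ σ₁ : Matrix n n ℂ} (hσ₀ : IsDensityMatrix σ₀)
    (hσ₁ : IsDensityMatrix σ₁) (f : ℝ → ℝ → EReal)
    (hf : ∀ t, 0 < t → ∀ x, 0 ≤ x → f t x = (((t + x)⁻¹ : ℝ) : EReal))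
    (h : ∀ t, 0 < t → fDivergence (f t) p₀ p₁ = maxFDivergence (f t) σ₀ σ₁) :
    ExistsCPTP p₀ p₁ σ₀ σ₁ := by
  obtain ⟨q₀, q₁, hq₀, hq₁, hq, hmin⟩ := exists_minimal_reverseTest hσ₀ hσ₁
  have hmax : ∀ t, 0 < t → maxFDivergence (f t) σ₀ σ₁ = (invDivergence t q₀ q₁ : EReal) := by
    intro t ht
    -- The optimal test lives on `n`, whereas the infimum ranges over densities on `Fin k`.
    let e := (Fintype.equivFin n).symm
    refine IsLeast.csInf_eq ⟨⟨_, q₀ ∘ e, q₁ ∘ e, comp_equiv_mem_stdSimplex hq₀ e,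
      comp_equiv_mem_stdSimplex hq₁ e, hq.comp_equiv e, ?_⟩, ?_⟩
    · rw [fDivergence_eq_invDivergence ht (hf t ht) (comp_equiv_mem_stdSimplex hq₀ e).1
        (comp_equiv_mem_stdSimplex hq₁ e).1, invDivergence_comp_equiv]
    · rintro _ ⟨k, r₀, r₁, hr₀, hr₁, hr, rfl⟩
      rw [fDivergence_eq_invDivergence ht (hf t ht) hr₀.1 hr₁.1, EReal.coe_le_coe_iff]
      exact hmin t ht k r₀ r₁ hr₀.1 hr₁.1 hr
  refine hq.of_levelMass_eq hp₀.1 hp₁.1 hq₀.1 hq₁.1 hσ₀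
    (levelMass_eq_of_invDivergence_eq hp₀ hp₁ hq₀ hq₁ fun t ht => ?_)
  have := h t ht
  rwa [hmax t ht, fDivergence_eq_invDivergence ht (hf t ht) hp₀.1 hp₁.1,
    EReal.coe_eq_coe_iff] at this

end Divergence

theorem mainTheorem2 {X n : Type*} [Fintype X] [DecidableEq X] [Fintype n] [DecidableEq n]
    (p₀ p₁ : X → ℝ) (hp₀ : p₀ ∈ stdSimplex ℝ X) (hp₁ : p₁ ∈ stdSimplex ℝ X)
    (σ₀ σ₁ : Matrix n n ℂ) (hσ₀ : IsDensityMatrix σ₀) (hσ₁ : IsDensityMatrix σ₁) :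
    ((∀ f : ℝ → ℝ, ContinuousOn f (Set.Ici 0) → OperatorConvex f →
        fDivergence (fun x => (f x : EReal)) p₀ p₁ =
          maxFDivergence (fun x => (f x : EReal)) σ₀ σ₁) →
      ExistsCPTP p₀ p₁ σ₀ σ₁) ∧
    (∀ s₀ : ℝ, 0 < s₀ → s₀ < 1 →
      (∀ t : ℝ, 0 ≤ t →
        fDivergence (invShift t) p₀ p₁ = maxFDivergence (invShift t) σ₀ σ₁) →
      (∀ s : ℝ, s₀ < s → s < 1 →
        fDivergence (negPow s) p₀ p₁ = maxFDivergence (negPow s) σ₀ σ₁) →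
      ExistsCPTP p₀ p₁ σ₀ σ₁) := by
  constructor
  · intro h
    refine existsCPTP_of_fDivergence_eq hp₀ hp₁ hσ₀ hσ₁
      (fun t x => (((t + x)⁻¹ : ℝ) : EReal)) (fun _ _ _ _ => rfl) fun t ht => ?_
    refine h (fun x => (t + x)⁻¹) ?_ (operatorConvex_inv_add ht)
    refine ContinuousOn.inv₀ (by fun_prop) fun x hx => ?_
    have : 0 ≤ x := hx
    positivity
  · intro s₀ _ _ h _
    refine existsCPTP_of_fDivergence_eq hp₀ hp₁ hσ₀ hσ₁ invShift ?_ fun t ht => h t ht.le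
    intro t ht x hx
    rw [invShift, if_neg (by positivity)]
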